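/- Let $\Lambda$ be a semigroup with a finite generating subset $F$, i.e. every element of $\Lambda$ is a product of elements of $F$ (if $\Lambda$ has an identity element $e$, then $e$ may be taken to be the empty product). The word length $|\gamma|_F$ of $\gamma\in\Lambda$ is the least $k\ge 1$ such that $\gamma$ is a product of $k$ elements of $F$, except that $|e|_F=0$ if $\Lambda$ has an identity element $e$. Let $\Lambda^e$ be $\Lambda$ if $\Lambda$ has an identity element, and $\Lambda$ with an identity element $e$ adjoined otherwise. Let $d_F$ be the distance on $\Lambda^e$ given by the length of shortest undirected paths in the Cayley graph with vertex set $\Lambda^e$ and an edge from $\gamma$ to $\gamma f$ for all $\gamma\in\Lambda^e$, $f\in F$. For $\kappa\in(0,1]$ and $\kappa'\ge 0$, let $\mathcal{QG}_F^{\kappa,\kappa'}$ be the set of sequences $(f_k)_{k\in\mathbb N}\in F^{\mathbb N}$ such that $|f_k\cdots f_{k+\ell}|_F\ge\kappa(\ell+1)-\kappa'$ for all $k,\ell\in\mathbb N$. Assume that $\Lambda$ has property (D): there exist $\kappa\in(0,1]$ and $\kappa',N\ge 0$ such that for every $\gamma\in\Lambda$ there are $(f_k)_{k\in\mathbb N}\in\mathcal{QG}_F^{\kappa,\kappa'}$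 and $n\ge 1$ with $d_F(\gamma,f_0\cdots f_{n-1})\le N$. Let $1\le i\le d-1$ be integers. For $g\in\mathrm{GL}(d,\mathbb R)$ let $\mu_1(g)\ge\dots\ge\mu_d(g)$ be the logarithms of the singular values of $g$. A semigroup homomorphism $\rho:\Lambda\to\mathrm{GL}(d,\mathbb R)$ is called $P_i$-Anosov if there exist $c,c'>0$ such that $\mu_i(\rho(\gamma))-\mu_{i+1}(\rho(\gamma))\ge c\,|\gamma|_F-c'$ for all $\gamma\in\Lambda$. Then the set of $P_i$-Anosov semigroup homomorphisms is an open subset of the space $\mathrm{Hom}(\Lambda,\mathrm{GL}(d,\mathbb R))$ of semigroup homomorphisms, endowed with the topology of uniform convergence on $F$. -/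

import Mathlib

open Topology

noncomputable section

namespace AnosovSemigroup

variable {Λ : Type*} [Semigroup Λ]

/-- `e` is a (two-sided) identity element of the semigroup `Λ`. A semigroup has at most one. -/
def IsIdentity (e : Λ) : Prop := ∀ x : Λ, e * x = x ∧ x * e = x

/-- The product `f k * f (k + 1) * ⋯ * f (k + l)`, which has `l + 1` factors. -/
def segProd (f : ℕ → Λ) (k : ℕ) : ℕ → Λ
  | 0 => f k
  | l + 1 => segProd f k l * f (k + (l + 1))

/-- `F` generates `Λ`: every element is a product of elements of `F`. The identity element of `Λ`,
if there is one, counts as the empty product, so that the usual (monoid) generating sets of a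
monoid are allowed as well. -/
def Generates (F : Set Λ) : Prop :=
  ∀ γ : Λ, IsIdentity γ ∨ γ ∈ Subsemigroup.closure F

open Classical in
/-- The word length `|γ|_F`: it is `0` for the identity element (if there is one), and otherwise the
least `k ≥ 1` such that `γ` is a product of `k` elements of `F`. -/
def wordLength (F : Set Λ) (γ : Λ) : ℕ :=
  if IsIdentity γ then 0
  else sInf {k : ℕ | ∃ (l : ℕ) (f : ℕ → Λ), k = l + 1 ∧ (∀ j ≤ l, f j ∈ F) ∧ segProd f 0 l = γ}

/-- The set of sequences `(f_k)` in `F` such that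
`|f_k ⋯ f_{k+l}|_F ≥ κ (l + 1) - κ'` for all `k, l`. -/
def QG (F : Set Λ) (κ κ' : ℝ) : Set (ℕ → Λ) :=
  {f | (∀ k, f k ∈ F) ∧
    ∀ k l : ℕ, κ * ((l : ℝ) + 1) - κ' ≤ (wordLength F (segProd f k l) : ℝ)}

variable (Λ) in
/-- The underlying set of `Λ^e`, the monoid obtained from `Λ` by adding an identity element
precisely when `Λ` does not have one already. -/
def AddIdentity : Type _ :=
  {x : WithOne Λ // x = 1 → ¬ ∃ e : Λ, IsIdentity e}

/-- The inclusion of `Λ` into `Λ^e`. -/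
def AddIdentity.of (γ : Λ) : AddIdentity Λ :=
  ⟨(γ : WithOne Λ), fun h => absurd h WithOne.coe_ne_one⟩

/-- The Cayley graph of `Λ` with respect to `F`, with orientations forgotten: the vertex set is
`Λ^e`, and there is an edge from `γ` to `γ f` for every vertex `γ` and every `f ∈ F` (loops are
dropped, which does not affect distances). -/
def cayleyGraph (F : Set Λ) : SimpleGraph (AddIdentity Λ) :=
  SimpleGraph.fromRel fun x y => ∃ f ∈ F, y.1 = x.1 * (f : WithOne Λ)

/-- The distance `d_F(γ, γ')`: the length of a shortest undirected path from `γ` to `γ'` in the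
Cayley graph (`⊤` if there is none, which does not occur when `F` generates `Λ`). -/
def cayleyDist (F : Set Λ) (γ γ' : Λ) : ℕ∞ :=
  (cayleyGraph F).edist (AddIdentity.of γ) (AddIdentity.of γ')

/-- Property (D), density of uniform quasigeodesic rays directed forward; the product
`segProd f 0 m` is `f_0 ⋯ f_{n-1}` with `n = m + 1 ≥ 1`. -/
def PropertyD (F : Set Λ) : Prop :=
  ∃ (κ κ' : ℝ) (N : ℕ), 0 < κ ∧ κ ≤ 1 ∧ 0 ≤ κ' ∧
    ∀ γ : Λ, ∃ f ∈ QG F κ κ', ∃ m : ℕ, cayleyDist F γ (segProd f 0 m) ≤ (N : ℕ∞)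

/-- `logSing g j` is `μ_j(g)`, the logarithm of the `j`-th largest singular value of `g` acting on
Euclidean space, for `1 ≤ j ≤ d`. (The singular values in the library are indexed from `0`.) -/
def logSing {d : ℕ} (g : GL (Fin d) ℝ) (j : ℕ) : ℝ :=
  Real.log ((Matrix.toEuclideanLin (g : Matrix (Fin d) (Fin d) ℝ)).singularValues (j - 1))

/-- `ρ` is `P_i`-Anosov: it has a uniform `i`-gap in singular values. -/
def IsAnosov (F : Set Λ) {d : ℕ} (i : ℕ) (ρ : Λ →ₙ* GL (Fin d) ℝ) : Prop :=
  ∃ c c' : ℝ, 0 < c ∧ 0 < c' ∧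
    ∀ γ : Λ, c * (wordLength F γ : ℝ) - c' ≤ logSing (ρ γ) i - logSing (ρ γ) (i + 1)

/-- The topology on `Hom(Λ, GL(d, ℝ))` of uniform convergence on the finite set `F`: since `F` is
finite, this is the topology induced by the product topology under `ρ ↦ (ρ f)_{f ∈ F}`. -/
abbrev homTopology (F : Set Λ) (d : ℕ) : TopologicalSpace (Λ →ₙ* GL (Fin d) ℝ) :=
  TopologicalSpace.induced (fun (ρ : Λ →ₙ* GL (Fin d) ℝ) (f : F) => ρ (f : Λ)) inferInstance

end AnosovSemigroup

end

noncomputable section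

namespace AnosovSemigroup

open Set Matrix
open scoped Matrix.Norms.L2Operator

section Compound

/-- The `j`-th compound matrix: the matrix of the `j`-th exterior power. -/
def compound {d : ℕ} (j : ℕ) (M : Matrix (Fin d) (Fin d) ℝ) :
    Matrix (powersetCard (Fin d) j) (powersetCard (Fin d) j) ℝ :=
  LinearMap.toMatrix ((Pi.basisFun ℝ (Fin d)).exteriorPower j)
    ((Pi.basisFun ℝ (Fin d)).exteriorPower j) (exteriorPower.map j (Matrix.toLin' M))

variable {d : ℕ} (j : ℕ)

lemma compound_apply (M : Matrix (Fin d) (Fin d) ℝ) (s t : powersetCard (Fin d) j) :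
    compound j M s t = (M.submatrix (powersetCard.ofFinEmbEquiv.symm s)
      (powersetCard.ofFinEmbEquiv.symm t)).det := by
  rw [compound, LinearMap.toMatrix_apply, exteriorPower.basis_apply,
    exteriorPower.ιMulti_family, exteriorPower.map_apply_ιMulti,
    exteriorPower.basis_repr_apply, exteriorPower.ιMultiDual_apply_ιMulti, ← Matrix.det_transpose]
  congr 1
  ext a b
  simp

lemma compound_mul (M N : Matrix (Fin d) (Fin d) ℝ) :
    compound j (M * N) = compound j M * compound j N := by
  rw [compound, Matrix.toLin'_mul, exteriorPower.map_comp, LinearMap.toMatrix_comp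
    _ ((Pi.basisFun ℝ (Fin d)).exteriorPower j)]
  rfl

lemma compound_one : compound j (1 : Matrix (Fin d) (Fin d) ℝ) = 1 := by
  rw [compound, Matrix.toLin'_one, exteriorPower.map_id, LinearMap.toMatrix_id]

lemma compound_transpose (M : Matrix (Fin d) (Fin d) ℝ) :
    compound j Mᵀ = (compound j M)ᵀ := by
  ext s t
  rw [Matrix.transpose_apply, compound_apply, compound_apply, ← Matrix.det_transpose,
    Matrix.transpose_submatrix, Matrix.transpose_transpose]

lemma compound_diagonal (σ : Fin d → ℝ) :
    compound j (Matrix.diagonal σ) =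
      Matrix.diagonal fun s => ∏ k, σ (powersetCard.ofFinEmbEquiv.symm s k) := by
  ext s t
  have h : (Matrix.diagonal σ).submatrix (powersetCard.ofFinEmbEquiv.symm s)
      (powersetCard.ofFinEmbEquiv.symm t) =
      Matrix.diagonal (fun k => σ (powersetCard.ofFinEmbEquiv.symm s k)) *
      (1 : Matrix (Fin d) (Fin d) ℝ).submatrix (powersetCard.ofFinEmbEquiv.symm s)
      (powersetCard.ofFinEmbEquiv.symm t) := by
    ext a b
    simp [Matrix.diagonal_mul, Matrix.diagonal_apply, Matrix.one_apply]
  rw [compound_apply, h, Matrix.det_mul, Matrix.det_diagonal, ← compound_apply, compound_one,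
    Matrix.diagonal_apply, Matrix.one_apply]
  simp

lemma continuous_compound :
    Continuous (compound j : Matrix (Fin d) (Fin d) ℝ → _) := by
  refine continuous_matrix fun s t => ?_
  simp only [compound_apply]
  fun_prop

lemma compound_mem_unitary {U : Matrix (Fin d) (Fin d) ℝ}
    (hU : U ∈ unitary (Matrix (Fin d) (Fin d) ℝ)) :
    compound j U ∈ unitary (Matrix (powersetCard (Fin d) j) (powersetCard (Fin d) j) ℝ) := by
  rw [Unitary.mem_iff] at hU ⊢
  simp only [Matrix.star_eq_conjTranspose, Matrix.conjTranspose_eq_transpose_of_trivial] at hU ⊢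
  rw [← compound_transpose, ← compound_mul, ← compound_mul, hU.1, hU.2, compound_one]
  exact ⟨rfl, rfl⟩

/-- The singular values of a square matrix. -/
def sing (M : Matrix (Fin d) (Fin d) ℝ) (k : ℕ) : ℝ := (Matrix.toEuclideanLin M).singularValues k

lemma sing_antitone (M : Matrix (Fin d) (Fin d) ℝ) : Antitone (sing M) :=
  LinearMap.singularValues_antitone _

lemma sing_pos (g : GL (Fin d) ℝ) {k : ℕ} (hk : k < d) :
    0 < sing (g : Matrix (Fin d) (Fin d) ℝ) k := by
  refine (LinearMap.injective_iff_forall_lt_finrank_singularValues_pos _).1 ?_ k (by simpa using hk)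
  intro x y hxy
  have h2 := congrArg (fun z => (Matrix.toEuclideanLin (g⁻¹).val) z) hxy
  simpa [Matrix.toLpLin_apply, Matrix.mulVec_mulVec, ← Units.val_mul] using h2

theorem exists_svd (g : GL (Fin d) ℝ) :
    ∃ U ∈ unitary (Matrix (Fin d) (Fin d) ℝ), ∃ V ∈ unitary (Matrix (Fin d) (Fin d) ℝ),
      (g : Matrix (Fin d) (Fin d) ℝ) =
        U * Matrix.diagonal (fun k : Fin d => sing (g : Matrix (Fin d) (Fin d) ℝ) k) * V := by
  set M : Matrix (Fin d) (Fin d) ℝ := g.val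
  set T := Matrix.toEuclideanLin M
  have hn : Module.finrank ℝ (EuclideanSpace ℝ (Fin d)) = d := by simp
  let v := T.isSymmetric_adjoint_comp_self.eigenvectorBasis hn
  let W : Matrix (Fin d) (Fin d) ℝ := Matrix.of fun a b => v b a
  have hW : Wᵀ * W = 1 := by
    ext a b
    have := orthonormal_iff_ite.1 v.orthonormal b a
    rw [Matrix.mul_apply, Matrix.one_apply]
    simp only [PiLp.inner_apply, RCLike.inner_apply, conj_trivial] at this
    simp only [W, Matrix.transpose_apply, Matrix.of_apply, this, eq_comm]
  have hW' : W * Wᵀ = 1 := mul_eq_one_comm.1 hW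
  have hMW : (Mᵀ * M) * W = W * Matrix.diagonal (fun k : Fin d => sing M k ^ 2) := by
    have key : ∀ b : Fin d, (Matrix.toEuclideanLin (Mᵀ * M)) (v b) = (sing M b ^ 2) • v b := by
      intro b
      have := T.isSymmetric_adjoint_comp_self.apply_eigenvectorBasis hn b
      rw [← LinearMap.sq_singularValues_fin] at this
      have h2 : Matrix.toEuclideanLin (Mᵀ * M) = T.adjoint ∘ₗ T := by
        rw [← Matrix.conjTranspose_eq_transpose_of_trivial, Matrix.toLpLin_mul_same,
          Matrix.toEuclideanLin_conjTranspose_eq_adjoint]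
      rw [h2]
      exact this
    ext a b
    have := congrArg (fun z => z a) (key b)
    simp [Matrix.toLpLin_apply] at this
    rw [Matrix.mul_apply]
    simp only [Matrix.mulVec, dotProduct] at this
    simp [W, this, Matrix.mul_diagonal, mul_comm]
  have hpos : ∀ k : Fin d, sing M k ≠ 0 := fun k => (sing_pos g k.2).ne'
  have hD : Matrix.diagonal (fun k : Fin d => (sing M k)⁻¹) * Matrix.diagonal
      (fun k : Fin d => sing M k) = 1 := by
    simp [Matrix.diagonal_mul_diagonal, hpos]
  have hU : (M * W * Matrix.diagonal (fun k : Fin d => (sing M k)⁻¹))ᵀ *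
      (M * W * Matrix.diagonal (fun k : Fin d => (sing M k)⁻¹)) = 1 := by
    calc _ = Matrix.diagonal (fun k : Fin d => (sing M k)⁻¹) * (Wᵀ * ((Mᵀ * M) * W)) *
          Matrix.diagonal (fun k : Fin d => (sing M k)⁻¹) := by
          simp only [Matrix.transpose_mul, Matrix.diagonal_transpose, Matrix.mul_assoc]
      _ = 1 := by
          rw [hMW, ← Matrix.mul_assoc Wᵀ, hW, Matrix.one_mul, Matrix.diagonal_mul_diagonal,
            Matrix.diagonal_mul_diagonal, ← Matrix.diagonal_one]
          congr 1
          ext k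
          have := hpos k
          field_simp
  refine ⟨M * W * Matrix.diagonal (fun k : Fin d => (sing M k)⁻¹), ?_, Wᵀ, ?_, ?_⟩
  · rw [Unitary.mem_iff]
    simp only [Matrix.star_eq_conjTranspose, Matrix.conjTranspose_eq_transpose_of_trivial]
    exact ⟨hU, mul_eq_one_comm.1 hU⟩
  · rw [Unitary.mem_iff]
    simp only [Matrix.star_eq_conjTranspose, Matrix.conjTranspose_eq_transpose_of_trivial,
      Matrix.transpose_transpose]
    exact ⟨hW', hW⟩
  · rw [Matrix.mul_assoc (M * W), hD, Matrix.mul_one, Matrix.mul_assoc, hW', Matrix.mul_one]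

lemma le_of_strictMono {d j : ℕ} {s : Fin j → Fin d} (hs : StrictMono s) (k : Fin j) :
    (k : ℕ) ≤ s k := by
  have : ∀ n (hn : n < j), n ≤ (s ⟨n, hn⟩ : ℕ) := by
    intro n
    induction n with
    | zero => intro _; exact Nat.zero_le _
    | succ n ih =>
      intro hn
      exact (ih (by omega)).trans_lt (hs (by simp [Fin.lt_def]))
  exact this k k.2

/-- The initial `j`-element subset of `Fin d`. -/
def initialSet {d j : ℕ} (hj : j ≤ d) : powersetCard (Fin d) j :=
  powersetCard.ofFinEmbEquiv (Fin.castLEOrderEmb hj)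

lemma prod_initialSet (σ : ℕ → ℝ) {d j : ℕ} (hj : j ≤ d) :
    ∏ k, σ (powersetCard.ofFinEmbEquiv.symm (initialSet hj) k) = ∏ k ∈ Finset.range j, σ k := by
  rw [Finset.prod_range]
  simp [initialSet]

lemma prod_le_prod_range {σ : ℕ → ℝ} (hσ : Antitone σ) {d j : ℕ} (h0 : ∀ k < d, 0 < σ k)
    (s : powersetCard (Fin d) j) :
    ∏ k, σ (powersetCard.ofFinEmbEquiv.symm s k) ≤ ∏ k ∈ Finset.range j, σ k := by
  rw [Finset.prod_range]
  exact Finset.prod_le_prod (fun k _ => (h0 _ (Fin.is_lt _)).le) fun k _ =>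
    hσ (le_of_strictMono (OrderEmbedding.strictMono _) k)

lemma prod_le_of_ne_initialSet {σ : ℕ → ℝ} (hσ : Antitone σ) {d m : ℕ} (h0 : ∀ k < d, 0 < σ k)
    (hm : m + 1 ≤ d) (s : powersetCard (Fin d) (m + 1)) (hs : s ≠ initialSet hm) :
    ∏ k, σ (powersetCard.ofFinEmbEquiv.symm s k) ≤
      (∏ k ∈ Finset.range m, σ k) * σ (m + 1) := by
  have hmono : StrictMono (powersetCard.ofFinEmbEquiv.symm s) := OrderEmbedding.strictMono _
  have hlast : m + 1 ≤ (powersetCard.ofFinEmbEquiv.symm s (Fin.last m) : ℕ) := by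
    by_contra! hlt
    apply hs
    have hsub : (s : Finset (Fin d)) ⊆ (initialSet hm : Finset (Fin d)) := by
      intro x hx
      obtain ⟨k, rfl⟩ := (powersetCard.mem_range_ofFinEmbEquiv_symm_iff_mem s x).2 hx
      rw [powersetCard.mem_coe_iff, initialSet, powersetCard.mem_ofFinEmbEquiv_iff_mem_range]
      exact ⟨⟨_, lt_of_le_of_lt (Fin.le_def.1 (hmono.monotone (Fin.le_last k))) hlt⟩, Fin.ext rfl⟩
    exact Subtype.ext (Finset.eq_of_subset_of_card_le hsub
      ((initialSet hm).2.trans s.2.symm).le)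
  rw [Fin.prod_univ_castSucc, Finset.prod_range]
  exact mul_le_mul (Finset.prod_le_prod (fun k _ => (h0 _ (Fin.is_lt _)).le) fun k _ =>
    hσ (le_of_strictMono hmono k.castSucc)) (hσ hlast) (h0 _ (Fin.is_lt _)).le
    (Finset.prod_nonneg fun k _ => (h0 _ (by omega)).le)

lemma norm_unitary_mul_mul {n : Type*} [Fintype n] [DecidableEq n] {X Y : Matrix n n ℝ}
    (hX : X ∈ unitary (Matrix n n ℝ)) (hY : Y ∈ unitary (Matrix n n ℝ)) (D : Matrix n n ℝ) :
    ‖X * D * Y‖ = ‖D‖ := by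
  rw [CStarRing.norm_mul_mem_unitary _ hY, CStarRing.norm_mem_unitary_mul _ hX]

lemma exists_svd_compound (g : GL (Fin d) ℝ) :
    ∃ X ∈ unitary (Matrix (powersetCard (Fin d) j) (powersetCard (Fin d) j) ℝ),
    ∃ Y ∈ unitary (Matrix (powersetCard (Fin d) j) (powersetCard (Fin d) j) ℝ),
      compound j g.val = X * Matrix.diagonal
        (fun s : powersetCard (Fin d) j => ∏ k, sing g.val (powersetCard.ofFinEmbEquiv.symm s k)) * Y := by
  obtain ⟨U, hU, V, hV, h⟩ := exists_svd g
  refine ⟨_, compound_mem_unitary j hU, _, compound_mem_unitary j hV, ?_⟩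
  rw [← compound_diagonal j (fun k : Fin d => sing g.val k), ← compound_mul, ← compound_mul, ← h]

lemma norm_compound (g : GL (Fin d) ℝ) {j : ℕ} (hj : j ≤ d) :
    ‖compound j g.val‖ = ∏ k ∈ Finset.range j, sing g.val k := by
  obtain ⟨X, hX, Y, hY, h⟩ := exists_svd_compound j g
  have hpos : ∀ k < d, 0 < sing g.val k := fun k hk => sing_pos g hk
  have hprod : 0 ≤ ∏ k ∈ Finset.range j, sing g.val k :=
    Finset.prod_nonneg fun k hk => (hpos k (by simp at hk; omega)).le
  rw [h, norm_unitary_mul_mul hX hY, Matrix.l2_opNorm_diagonal]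
  refine le_antisymm ((pi_norm_le_iff_of_nonneg hprod).2 fun s => ?_) ?_
  · rw [Real.norm_of_nonneg (Finset.prod_nonneg fun k _ => (hpos _ (Fin.is_lt _)).le)]
    exact prod_le_prod_range (sing_antitone _) hpos s
  · refine le_trans ?_ (norm_le_pi_norm _ (initialSet hj))
    rw [prod_initialSet]
    exact le_abs_self _

end Compound

section Estimate

section Rank

variable {n : Type*} [Fintype n] [DecidableEq n]

lemma single_mul_mul_single (M : Matrix n n ℝ) (o : n) :
    Matrix.single o o (1 : ℝ) * M * Matrix.single o o 1 = M o o • Matrix.single o o 1 := by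
  simp [Matrix.smul_single]

lemma norm_single_one (o : n) : ‖(Matrix.single o o (1 : ℝ) : Matrix n n ℝ)‖ = 1 := by
  rw [← Matrix.diagonal_single, Matrix.l2_opNorm_diagonal, Pi.norm_single, norm_one]

/-- The norm is multiplicative on the two halves of a rank one matrix. -/
lemma norm_mul_single_mul (B C : Matrix n n ℝ) (o : n) :
    ‖B * Matrix.single o o (1 : ℝ) * C‖ =
      ‖B * Matrix.single o o (1 : ℝ)‖ * ‖Matrix.single o o (1 : ℝ) * C‖ := by
  set E : Matrix n n ℝ := Matrix.single o o 1 with hE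
  have hEs : star E = E := by
    simp [hE, Matrix.star_eq_conjTranspose]
  have hEE : E * E = E := by simp [hE]
  have h1 : star (B * E) * (B * E) = (star B * B) o o • E := by
    rw [star_mul, hEs, ← single_mul_mul_single]
    simp only [Matrix.mul_assoc, hE]
  have h2 : ‖B * E‖ ^ 2 = |(star B * B) o o| := by
    rw [sq, ← CStarRing.norm_star_mul_self, h1, norm_smul, norm_single_one, mul_one,
      Real.norm_eq_abs]
  have h3 : ‖B * E * C‖ ^ 2 = (‖B * E‖ * ‖E * C‖) ^ 2 := by
    have : star (B * E * C) * (B * E * C) = (star B * B) o o • (star (E * C) * (E * C)) := by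
      calc _ = star C * (star (B * E) * (B * E)) * C := by
            rw [star_mul (B * E)]; simp only [Matrix.mul_assoc]
        _ = _ := by
            rw [h1, star_mul, hEs, Matrix.mul_smul, Matrix.smul_mul]
            congr 1
            calc star C * E * C = star C * (E * E) * C := by rw [hEE]
              _ = _ := by simp only [Matrix.mul_assoc]
    rw [sq, ← CStarRing.norm_star_mul_self, this, norm_smul, mul_pow, h2, Real.norm_eq_abs, sq,
      CStarRing.norm_star_mul_self]
  exact (sq_eq_sq₀ (norm_nonneg _) (by positivity)).1 h3

/-- If `D` is diagonal with one dominating entry, then `‖B D‖ ‖D C‖` is at most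
`‖B D C‖ ‖D‖`, up to a factor close to one. -/
lemma norm_mul_norm_le_of_diagonal {B B' C C' : Matrix n n ℝ} {τ : n → ℝ} {o : n} {r K : ℝ}
    (hB' : B' * B = 1) (hC' : C * C' = 1) (hB : ‖B‖ ≤ K) (hBi : ‖B'‖ ≤ K) (hC : ‖C‖ ≤ K)
    (hCi : ‖C'‖ ≤ K) (hK : 1 ≤ K) (hr : 0 ≤ r) (hr1 : r ≤ 1) (ho : 0 ≤ τ o)
    (hτ : ∀ s ≠ o, |τ s| ≤ r * τ o) :
    ‖B * Matrix.diagonal τ‖ * ‖Matrix.diagonal τ * C‖ ≤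
      ‖B * Matrix.diagonal τ * C‖ * ‖Matrix.diagonal τ‖ * (1 + 5 * K ^ 4 * r) := by
  set D : Matrix n n ℝ := Matrix.diagonal τ with hD
  set E : Matrix n n ℝ := Matrix.single o o 1 with hE
  set t := τ o with ht
  set R : Matrix n n ℝ := D - t • E with hR
  have hK0 : 0 ≤ K := by linarith
  have hDR : D = t • E + R := by simp [hR]
  have hRn : ‖R‖ ≤ r * t := by
    have : R = Matrix.diagonal (τ - Pi.single o t) := by
      rw [hR, hD, hE, ← Matrix.diagonal_single, ← Matrix.diagonal_smul, Matrix.diagonal_sub]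
      congr 1
      ext s
      simp [Pi.single_apply]
    rw [this, Matrix.l2_opNorm_diagonal]
    refine (pi_norm_le_iff_of_nonneg (by positivity)).2 fun s => ?_
    by_cases hs : s = o
    · subst hs
      simpa [ht] using mul_nonneg hr ho
    · simpa [Pi.single_apply, hs] using hτ s hs
  have htD : t ≤ ‖D‖ := by
    rw [hD, Matrix.l2_opNorm_diagonal]
    exact (le_abs_self _).trans (norm_le_pi_norm τ o)
  have hEn : ‖E‖ = 1 := norm_single_one o
  have hβ : ‖B * E‖ ≤ K := (norm_mul_le _ _).trans (by rw [hEn, mul_one]; exact hB)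
  have hγ : ‖E * C‖ ≤ K := (norm_mul_le _ _).trans (by rw [hEn, one_mul]; exact hC)
  have hBD : ‖B * D‖ ≤ t * (‖B * E‖ + K * r) := by
    rw [hDR, Matrix.mul_add, Matrix.mul_smul]
    refine (norm_add_le _ _).trans ?_
    rw [norm_smul, Real.norm_of_nonneg ho]
    have := (norm_mul_le B R).trans (mul_le_mul hB hRn (norm_nonneg _) hK0)
    linarith
  have hDC : ‖D * C‖ ≤ t * (‖E * C‖ + K * r) := by
    rw [hDR, Matrix.add_mul, Matrix.smul_mul]
    refine (norm_add_le _ _).trans ?_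
    rw [norm_smul, Real.norm_of_nonneg ho]
    have := (norm_mul_le R C).trans (mul_le_mul hRn hC (norm_nonneg _) (by positivity))
    linarith
  have hBDC : t * (‖B * E‖ * ‖E * C‖ - K ^ 2 * r) ≤ ‖B * D * C‖ := by
    have h1 : B * D * C = t • (B * E * C) + B * R * C := by
      rw [hDR, Matrix.mul_add, Matrix.add_mul, Matrix.mul_smul, Matrix.smul_mul]
    have h2 := norm_sub_le_norm_add (t • (B * E * C)) (B * R * C)
    rw [norm_smul, Real.norm_of_nonneg ho, norm_mul_single_mul] at h2
    have h3 : ‖B * R * C‖ ≤ K * (r * t) * K :=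
      (norm_mul_le _ _).trans (mul_le_mul ((norm_mul_le _ _).trans
        (mul_le_mul hB hRn (norm_nonneg _) hK0)) hC (norm_nonneg _) (by positivity))
    rw [h1]
    linarith
  have hDle : ‖D‖ ≤ K ^ 2 * ‖B * D * C‖ := by
    have h1 : D = B' * (B * D * C) * C' := by
      calc D = (B' * B) * D * (C * C') := by rw [hB', hC', Matrix.one_mul, Matrix.mul_one]
        _ = _ := by simp only [Matrix.mul_assoc]
    calc ‖D‖ = ‖B' * (B * D * C) * C'‖ := by rw [← h1]
      _ ≤ K * ‖B * D * C‖ * K := (norm_mul_le _ _).trans (mul_le_mul ((norm_mul_le _ _).trans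
        (mul_le_mul_of_nonneg_right hBi (norm_nonneg _))) hCi (norm_nonneg _) (by positivity))
      _ = _ := by ring
  have hX := norm_nonneg (B * D * C)
  have hb := norm_nonneg (B * E)
  have hg := norm_nonneg (E * C)
  set X := ‖B * D * C‖
  set β := ‖B * E‖
  set γ := ‖E * C‖
  have hDn : 0 ≤ ‖D‖ := norm_nonneg D
  have e1 : ‖B * D‖ * ‖D * C‖ ≤ (t * (β + K * r)) * (t * (γ + K * r)) :=
    mul_le_mul hBD hDC (norm_nonneg _) (by positivity)
  have e2 : (β + K * r) * (γ + K * r) ≤ (β * γ - K ^ 2 * r) + 4 * K ^ 2 * r := by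
    have a1 : β * (K * r) ≤ K * (K * r) := mul_le_mul_of_nonneg_right hβ (by positivity)
    have a2 : γ * (K * r) ≤ K * (K * r) := mul_le_mul_of_nonneg_right hγ (by positivity)
    have a3 : K ^ 2 * r * r ≤ K ^ 2 * r * 1 := mul_le_mul_of_nonneg_left hr1 (by positivity)
    nlinarith
  have e3 : t * (t * (β * γ - K ^ 2 * r)) ≤ t * X := mul_le_mul_of_nonneg_left hBDC ho
  have e4 : t * X ≤ ‖D‖ * X := mul_le_mul_of_nonneg_right htD hX
  have e5 : t * t ≤ ‖D‖ * (K ^ 2 * X) := mul_le_mul htD (htD.trans hDle) ho hDn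
  have e6 : t * t * ((β + K * r) * (γ + K * r)) ≤
      t * t * ((β * γ - K ^ 2 * r) + 4 * K ^ 2 * r) := mul_le_mul_of_nonneg_left e2 (by positivity)
  have e7 : t * t * (4 * K ^ 2 * r) ≤ ‖D‖ * (K ^ 2 * X) * (4 * K ^ 2 * r) :=
    mul_le_mul_of_nonneg_right e5 (by positivity)
  have e8 : 0 ≤ X * ‖D‖ * (K ^ 4 * r) := by positivity
  nlinarith

lemma norm_mul_norm_le {B B' C C' X Y : Matrix n n ℝ} {τ : n → ℝ} {o : n} {r K : ℝ}
    (hX : X ∈ unitary (Matrix n n ℝ)) (hY : Y ∈ unitary (Matrix n n ℝ))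
    (hB' : B' * B = 1) (hC' : C * C' = 1) (hB : ‖B‖ ≤ K) (hBi : ‖B'‖ ≤ K) (hC : ‖C‖ ≤ K)
    (hCi : ‖C'‖ ≤ K) (hK : 1 ≤ K) (hr : 0 ≤ r) (hr1 : r ≤ 1) (ho : 0 ≤ τ o)
    (hτ : ∀ s ≠ o, |τ s| ≤ r * τ o) {P : Matrix n n ℝ} (hP : P = X * Matrix.diagonal τ * Y) :
    ‖B * P‖ * ‖P * C‖ ≤ ‖B * P * C‖ * ‖P‖ * (1 + 5 * K ^ 4 * r) := by
  have h := norm_mul_norm_le_of_diagonal (B := B * X) (B' := star X * B') (C := Y * C)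
    (C' := C' * star Y) (τ := τ) (o := o) (r := r) (K := K) ?_ ?_ ?_ ?_ ?_ ?_ hK hr hr1 ho hτ
  · have h1 : ‖B * P‖ = ‖B * X * Matrix.diagonal τ‖ := by
      rw [hP, ← CStarRing.norm_mul_mem_unitary (B * X * Matrix.diagonal τ) hY]
      simp only [Matrix.mul_assoc]
    have h2 : ‖P * C‖ = ‖Matrix.diagonal τ * (Y * C)‖ := by
      rw [hP, ← CStarRing.norm_mem_unitary_mul (Matrix.diagonal τ * (Y * C)) hX]
      simp only [Matrix.mul_assoc]
    have h3 : ‖B * P * C‖ = ‖B * X * Matrix.diagonal τ * (Y * C)‖ := by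
      rw [hP]
      simp only [Matrix.mul_assoc]
    rw [h1, h2, h3, hP, norm_unitary_mul_mul hX hY]
    exact h
  · calc star X * B' * (B * X) = star X * (B' * B) * X := by simp only [Matrix.mul_assoc]
      _ = 1 := by rw [hB', Matrix.mul_one, (Unitary.mem_iff.1 hX).1]
  · calc Y * C * (C' * star Y) = Y * (C * C') * star Y := by simp only [Matrix.mul_assoc]
      _ = 1 := by rw [hC', Matrix.mul_one, (Unitary.mem_iff.1 hY).2]
  · rwa [CStarRing.norm_mul_mem_unitary _ hX]
  · rwa [CStarRing.norm_mem_unitary_mul _ (Unitary.star_mem hX)]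
  · rwa [CStarRing.norm_mem_unitary_mul _ hY]
  · rwa [CStarRing.norm_mul_mem_unitary _ (Unitary.star_mem hY)]

end Rank

variable {d : ℕ}

/-- The logarithm of the norm of the `j`-th compound matrix, that is, the sum of the logarithms of
the `j` largest singular values. -/
def logVol (j : ℕ) (g : GL (Fin d) ℝ) : ℝ := Real.log ‖compound j g.val‖

/-- The gap between the logarithms of the singular values numbered `m` and `m + 1` from `0`. -/
def gap (m : ℕ) (g : GL (Fin d) ℝ) : ℝ := 2 * logVol (m + 1) g - logVol m g - logVol (m + 2) g

lemma logVol_eq_sum (g : GL (Fin d) ℝ) {j : ℕ} (hj : j ≤ d) :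
    logVol j g = ∑ k ∈ Finset.range j, Real.log (sing g.val k) := by
  rw [logVol, norm_compound g hj, Real.log_prod]
  intro k hk
  exact (sing_pos g (by simp at hk; omega)).ne'

lemma gap_eq (g : GL (Fin d) ℝ) {m : ℕ} (hm : m + 2 ≤ d) :
    gap m g = Real.log (sing g.val m) - Real.log (sing g.val (m + 1)) := by
  rw [gap, logVol_eq_sum g hm, logVol_eq_sum g (by omega : m + 1 ≤ d),
    logVol_eq_sum g (by omega : m ≤ d), Finset.sum_range_succ _ (m + 1), Finset.sum_range_succ _ m]
  ring

lemma logSing_sub (g : GL (Fin d) ℝ) {m : ℕ} (hm : m + 2 ≤ d) :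
    logSing g (m + 1) - logSing g (m + 1 + 1) = gap m g := by
  rw [gap_eq g hm]
  rfl

lemma norm_compound_pos (g : GL (Fin d) ℝ) {j : ℕ} (hj : j ≤ d) : 0 < ‖compound j g.val‖ := by
  rw [norm_compound g hj]
  exact Finset.prod_pos fun k hk => sing_pos g (by simp at hk; omega)

lemma logVol_one (j : ℕ) : logVol j (1 : GL (Fin d) ℝ) = 0 := by
  rw [logVol, Units.val_one, compound_one]
  rcases isEmpty_or_nonempty (powersetCard (Fin d) j) with h | h
  · simp [Subsingleton.elim (1 : Matrix (powersetCard (Fin d) j) (powersetCard (Fin d) j) ℝ) 0]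
  · simp

lemma gap_one (m : ℕ) : gap m (1 : GL (Fin d) ℝ) = 0 := by simp [gap, logVol_one]

lemma logVol_mul_le (g h : GL (Fin d) ℝ) {j : ℕ} (hj : j ≤ d) :
    logVol j (g * h) ≤ logVol j g + logVol j h := by
  rw [logVol, logVol, logVol, ← Real.log_mul (norm_compound_pos g hj).ne'
    (norm_compound_pos h hj).ne', Units.val_mul, compound_mul]
  refine Real.log_le_log ?_ (norm_mul_le _ _)
  rw [← compound_mul, ← Units.val_mul]
  exact norm_compound_pos _ hj

/-- The compound matrices of `g` and `g⁻¹` of order at most `m + 2` have norm at most `K`. -/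
def CompoundBound (m : ℕ) (K : ℝ) (g : GL (Fin d) ℝ) : Prop :=
  ∀ j ≤ m + 2, ‖compound j g.val‖ ≤ K ∧ ‖compound j (g⁻¹).val‖ ≤ K

lemma compound_val_inv_mul (j : ℕ) (g : GL (Fin d) ℝ) :
    compound j (g⁻¹).val * compound j g.val = 1 := by
  rw [← compound_mul, ← Units.val_mul, inv_mul_cancel, Units.val_one, compound_one]

lemma log_add_log_le {w x y z q : ℝ} (hw : 0 < w) (hx : 0 < x) (hy : 0 < y) (hz : 0 < z)
    (hq : 0 ≤ q) (h : w * x ≤ y * z * (1 + q)) :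
    Real.log w + Real.log x ≤ Real.log y + Real.log z + q := by
  have h1 := Real.log_le_log (by positivity) h
  have h2 := Real.log_le_sub_one_of_pos (by linarith : 0 < 1 + q)
  rw [Real.log_mul hw.ne' hx.ne', Real.log_mul (by positivity) (by positivity),
    Real.log_mul hy.ne' hz.ne'] at h1
  linarith

theorem logVol_add_logVol_le {m : ℕ} (hm : m + 2 ≤ d) {K : ℝ} (hK : 1 ≤ K) {b c : GL (Fin d) ℝ}
    (hb : CompoundBound m K b) (hc : CompoundBound m K c) (p : GL (Fin d) ℝ) :
    logVol (m + 1) (b * p) + logVol (m + 1) (p * c) ≤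
      logVol (m + 1) (b * p * c) + logVol (m + 1) p + 5 * K ^ 4 * Real.exp (-gap m p) := by
  have hm1 : m + 1 ≤ d := by omega
  have hpos : ∀ k < d, 0 < sing p.val k := fun k hk => sing_pos p hk
  have h0 := hpos m (by omega)
  have h1 := hpos (m + 1) (by omega)
  have hr : Real.exp (-gap m p) = sing p.val (m + 1) / sing p.val m := by
    rw [gap_eq p hm, neg_sub, Real.exp_sub, Real.exp_log h0, Real.exp_log h1]
  have hr0 : 0 ≤ Real.exp (-gap m p) := (Real.exp_pos _).le
  have hr1 : Real.exp (-gap m p) ≤ 1 := by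
    rw [hr, div_le_one h0]
    exact sing_antitone _ (Nat.le_succ m)
  obtain ⟨X, hX, Y, hY, h⟩ := exists_svd_compound (m + 1) p
  have key := norm_mul_norm_le (o := initialSet hm1) hX hY (compound_val_inv_mul (m + 1) b)
    (by simpa using compound_val_inv_mul (m + 1) c⁻¹)
    (hb _ (by omega)).1 (hb _ (by omega)).2 (hc _ (by omega)).1 (hc _ (by omega)).2 hK hr0 hr1
    (Finset.prod_nonneg fun k _ => (hpos _ (Fin.is_lt _)).le) ?_ h
  · simp only [← compound_mul, ← Units.val_mul] at key
    have q1 := norm_compound_pos (b * p) hm1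
    have q2 := norm_compound_pos (p * c) hm1
    have q3 := norm_compound_pos (b * p * c) hm1
    have q4 := norm_compound_pos p hm1
    exact log_add_log_le q1 q2 q3 q4 (by positivity) key
  · intro s hs
    rw [abs_of_nonneg (Finset.prod_nonneg fun k _ => (hpos _ (Fin.is_lt _)).le), prod_initialSet,
      hr, Finset.prod_range_succ]
    refine (prod_le_of_ne_initialSet (sing_antitone _) hpos hm1 s hs).trans_eq ?_
    field_simp

end Estimate

section Growth

/-- A function of intervals with exponentially small mixed differences is superadditive up to a
constant; `a k m` is its value at the interval starting at `k` of length `m`. -/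
theorem add_le_of_mixed_difference {a : ℕ → ℕ → ℝ} (h0 : ∀ k, a k 0 = 0) {C r : ℝ} (hC : 0 ≤ C)
    (hr : 0 ≤ r) (hr1 : r < 1) {L : ℕ}
    (hM : ∀ k m, m + 2 ≤ L → a k (m + 1) + a (k + 1) (m + 1) ≤
      a k (m + 2) + a (k + 1) m + C * r ^ m) (k p q : ℕ) (hpq : p + q ≤ L) :
    a k p + a (k + p) q ≤ a k (p + q) + C / (1 - r) ^ 2 := by
  have hsum : ∀ n, ∑ x ∈ Finset.range n, r ^ x ≤ 1 / (1 - r) := fun n => by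
    rw [← tsum_geometric_of_lt_one hr hr1 |>.trans (one_div _).symm]
    exact (summable_geometric_of_lt_one hr hr1).sum_le_tsum _ fun _ _ => by positivity
  have step : ∀ p k y, p + y + 1 ≤ L → a (k + p) (y + 1) - a (k + p) y ≤
      a k (p + y + 1) - a k (p + y) + C * (r ^ y * ∑ x ∈ Finset.range p, r ^ x) := by
    intro p
    induction p with
    | zero => intro k y _; simp
    | succ p ih =>
      intro k y hy
      have h1 := ih (k + 1) y (by omega)
      have h2 := hM k (p + y) (by omega)
      rw [Finset.sum_range_succ, mul_add, mul_add, ← pow_add, add_comm y p]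
      rw [show k + 1 + p = k + (p + 1) by ring] at h1
      rw [show p + 1 + y = p + y + 1 by ring]
      linarith
  have main : ∀ q, p + q ≤ L → a k p + a (k + p) q ≤
      a k (p + q) + C / (1 - r) * ∑ y ∈ Finset.range q, r ^ y := by
    intro q
    induction q with
    | zero => intro _; simp [h0]
    | succ q ih =>
      intro hq
      have h1 := ih (by omega)
      have h2 := step p k q (by omega)
      have h3 : C * (r ^ q * ∑ x ∈ Finset.range p, r ^ x) ≤ C * (r ^ q * (1 / (1 - r))) := by
        have := hsum p
        gcongr
      rw [Finset.sum_range_succ, ← add_assoc p q 1]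
      have h4 : C * (r ^ q * (1 / (1 - r))) = C / (1 - r) * r ^ q := by ring
      linarith
  refine (main q hpq).trans (add_le_add_right ?_ _)
  have hpos : 0 < 1 - r := by linarith
  calc C / (1 - r) * ∑ y ∈ Finset.range q, r ^ y ≤ C / (1 - r) * (1 / (1 - r)) :=
        mul_le_mul_of_nonneg_left (hsum q) (by positivity)
    _ = _ := by field_simp

/-- The product `A k * A (k + 1) * ⋯ * A (k + n - 1)`, with `n` factors. -/
def segment {G : Type*} [Monoid G] (A : ℕ → G) (k n : ℕ) : G :=
  ((List.range n).map fun j => A (k + j)).prod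

section segment

variable {G : Type*} [Monoid G] (A : ℕ → G) (k n : ℕ)

@[simp] lemma segment_zero : segment A k 0 = 1 := by simp [segment]

lemma segment_succ : segment A k (n + 1) = segment A k n * A (k + n) := by
  simp [segment, List.range_succ]

lemma segment_add (m : ℕ) : segment A k (n + m) = segment A k n * segment A (k + n) m := by
  induction m with
  | zero => simp
  | succ m ih => rw [← add_assoc, segment_succ, ih, segment_succ, mul_assoc, add_assoc]

lemma segment_succ' : segment A k (n + 1) = A k * segment A (k + 1) n := by
  rw [add_comm n, segment_add, segment_succ, segment_zero, one_mul, add_zero]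

end segment

variable {d : ℕ}

/-- Linear growth of the gap propagates from short products to all products. -/
theorem exists_length_forall_gap {m : ℕ} (hm : m + 2 ≤ d) {K c c' : ℝ} (hK : 1 ≤ K) (hc : 0 < c) :
    ∃ n : ℕ, ∀ A : ℕ → GL (Fin d) ℝ, (∀ k, CompoundBound m K (A k)) →
      (∀ k, ∀ l ≤ n, c * l - c' ≤ gap m (segment A k l)) →
      ∀ k l, c / 2 * l - c' ≤ gap m (segment A k l) := by
  set r := Real.exp (-(c / 2)) with hr
  have hr0 : 0 ≤ r := (Real.exp_pos _).le
  have hr1 : r < 1 := by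
    rw [hr, ← Real.exp_zero]
    exact Real.exp_lt_exp.2 (by linarith)
  set C := 5 * K ^ 4 * Real.exp c' with hCdef
  have hC : 0 ≤ C := by positivity
  set D := C / (1 - r) ^ 2
  obtain ⟨n, hn⟩ := exists_nat_gt (max 0 ((c' + 2 * D) / (c / 2)))
  rw [max_lt_iff, div_lt_iff₀ (by linarith), Nat.cast_pos] at hn
  refine ⟨n, fun A hA hshort k l => ?_⟩
  induction l using Nat.strong_induction_on generalizing k with
  | _ l ih =>
  rcases le_or_gt l n with hl | hl
  · have := hshort k l hl
    have : 0 ≤ c * (l : ℝ) := by positivity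
    linarith
  obtain ⟨q, rfl⟩ := Nat.exists_eq_add_of_le hl.le
  have hsuper := add_le_of_mixed_difference (a := fun k l => logVol (m + 1) (segment A k l))
    (fun k => by simp [logVol_one]) hC hr0 hr1 (L := n + q) (fun k l hlL => by
      have h1 := logVol_add_logVol_le hm hK (hA k) (hA (k + 1 + l)) (segment A (k + 1) l)
      rw [mul_assoc, ← segment_succ, ← segment_succ', ← segment_succ'] at h1
      refine h1.trans (add_le_add_right ?_ _)
      rw [hCdef, mul_assoc _ (Real.exp c'), hr, ← Real.exp_nat_mul, ← Real.exp_add]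
      have := ih l (by omega) (k + 1)
      gcongr
      linarith) k n q le_rfl
  have hsub1 := logVol_mul_le (segment A k n) (segment A (k + n) q) (by omega : m ≤ d)
  have hsub2 := logVol_mul_le (segment A k n) (segment A (k + n) q) hm
  rw [← segment_add] at hsub1 hsub2
  have h1 := hshort k n le_rfl
  have h2 := ih q (by omega) (k + n)
  simp only [gap] at h1 h2 ⊢
  push_cast
  linarith [hn.2]

end Growth

section Openness

lemma finite_words {α : Type*} {F : Set α} (hF : F.Finite) (n : ℕ) :
    {w : List α | w.length ≤ n ∧ ∀ x ∈ w, x ∈ F}.Finite := by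
  have := hF.to_subtype
  refine ((List.finite_length_le F n).image (List.map Subtype.val)).subset ?_
  rintro w ⟨hw, hwF⟩
  lift w to List F using hwF
  exact ⟨w, by simpa using hw, rfl⟩

section Topology

variable {d : ℕ}

lemma continuous_norm_compound (j : ℕ) :
    Continuous fun g : GL (Fin d) ℝ => ‖compound j g.val‖ :=
  ((continuous_compound j).comp Units.continuous_val).norm

lemma continuous_logVol {j : ℕ} (hj : j ≤ d) :
    Continuous (logVol j : GL (Fin d) ℝ → ℝ) :=
  (continuous_norm_compound j).log fun g => (norm_compound_pos g hj).ne'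

lemma continuous_gap {m : ℕ} (hm : m + 2 ≤ d) : Continuous (gap m : GL (Fin d) ℝ → ℝ) := by
  have h0 := continuous_logVol (d := d) (by omega : m ≤ d)
  have h1 := continuous_logVol (d := d) (by omega : m + 1 ≤ d)
  have h2 := continuous_logVol (d := d) hm
  unfold gap
  fun_prop

lemma exists_eventually_compoundBound (m : ℕ) (g : GL (Fin d) ℝ) :
    ∃ K, ∀ᶠ h in 𝓝 g, CompoundBound m K h := by
  have h1 : ∀ j, ∀ᶠ K in Filter.atTop, ∀ᶠ h in 𝓝 g,
      ‖compound j h.val‖ ≤ K ∧ ‖compound j (h⁻¹).val‖ ≤ K := by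
    intro j
    filter_upwards [Filter.eventually_gt_atTop ‖compound j g.val‖,
      Filter.eventually_gt_atTop ‖compound j (g⁻¹).val‖] with K hK1 hK2
    filter_upwards [(continuous_norm_compound j).continuousAt.eventually_lt_const hK1,
      ((continuous_norm_compound j).comp continuous_inv).continuousAt.eventually_lt_const hK2]
      with h a b using ⟨a.le, b.le⟩
  have h2 := (Filter.eventually_all_finite (Set.finite_Iic (m + 2))).2 fun j _ => h1 j
  obtain ⟨K, hK⟩ := h2.exists
  exact ⟨K, (Filter.eventually_all_finite (Set.finite_Iic (m + 2))).2 hK⟩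

lemma CompoundBound.mono {m : ℕ} {K K' : ℝ} (hK : K ≤ K') {g : GL (Fin d) ℝ}
    (h : CompoundBound m K g) : CompoundBound m K' g :=
  fun j hj => ⟨(h j hj).1.trans hK, (h j hj).2.trans hK⟩

end Topology

section Lipschitz

variable {d m : ℕ} {K : ℝ}

lemma abs_logVol_mul_sub_le {g h : GL (Fin d) ℝ} (hh : CompoundBound m K h) {j : ℕ}
    (hj : j ≤ m + 2) (hjd : j ≤ d) : |logVol j (g * h) - logVol j g| ≤ Real.log K := by
  have h1 := logVol_mul_le g h hjd
  have h2 := logVol_mul_le (g * h) h⁻¹ hjd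
  rw [mul_inv_cancel_right] at h2
  have h3 : logVol j h ≤ Real.log K :=
    Real.log_le_log (norm_compound_pos h hjd) (hh j hj).1
  have h4 : logVol j h⁻¹ ≤ Real.log K :=
    Real.log_le_log (norm_compound_pos h⁻¹ hjd) (hh j hj).2
  rw [abs_le]
  constructor <;> linarith

lemma abs_gap_mul_sub_le {g h : GL (Fin d) ℝ} (hm : m + 2 ≤ d) (hh : CompoundBound m K h) :
    |gap m (g * h) - gap m g| ≤ 4 * Real.log K := by
  have h0 := abs_le.1 (abs_logVol_mul_sub_le (g := g) hh (by omega : m ≤ m + 2) (by omega))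
  have h1 := abs_le.1 (abs_logVol_mul_sub_le (g := g) hh (by omega : m + 1 ≤ m + 2) (by omega))
  have h2 := abs_le.1 (abs_logVol_mul_sub_le (g := g) hh le_rfl hm)
  rw [abs_le]
  unfold gap
  constructor <;> linarith

lemma gap_segment_le {A : ℕ → GL (Fin d) ℝ} (hm : m + 2 ≤ d) (hA : ∀ k, CompoundBound m K (A k))
    (k l : ℕ) : gap m (segment A k l) ≤ 4 * Real.log K * l := by
  induction l with
  | zero => simp [gap_one]
  | succ l ih =>
    have := (abs_le.1 (abs_gap_mul_sub_le (g := segment A k l) hm (hA (k + l)))).2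
    rw [segment_succ]
    push_cast
    linarith

end Lipschitz

variable {Λ : Type*} [Semigroup Λ] {F : Set Λ} {d m : ℕ}

lemma abs_gap_sub_le_of_walk {K : ℝ} (hm : m + 2 ≤ d) (φ : WithOne Λ →* GL (Fin d) ℝ)
    (hφ : ∀ f ∈ F, CompoundBound m K (φ f)) {x y : AddIdentity Λ} (p : (cayleyGraph F).Walk x y) :
    |gap m (φ x.1) - gap m (φ y.1)| ≤ 4 * Real.log K * p.length := by
  induction p with
  | nil => simp
  | @cons u v w h p ih =>
    have hstep : |gap m (φ u.1) - gap m (φ v.1)| ≤ 4 * Real.log K := by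
      obtain ⟨-, ⟨f, hf, h⟩ | ⟨f, hf, h⟩⟩ := (SimpleGraph.fromRel_adj _ _ _).1 h
      · rw [h, map_mul, abs_sub_comm]
        exact abs_gap_mul_sub_le hm (hφ f hf)
      · rw [h, map_mul]
        exact abs_gap_mul_sub_le hm (hφ f hf)
    rw [SimpleGraph.Walk.length_cons]
    push_cast
    linarith [abs_sub_le (gap m (φ u.1)) (gap m (φ v.1)) (gap m (φ w.1))]

lemma abs_gap_sub_le_of_cayleyDist {K : ℝ} (hK : 1 ≤ K) (hm : m + 2 ≤ d)
    (ρ : Λ →ₙ* GL (Fin d) ℝ) (hρ : ∀ f ∈ F, CompoundBound m K (ρ f)) {γ δ : Λ} {N : ℕ}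
    (h : cayleyDist F γ δ ≤ N) : |gap m (ρ γ) - gap m (ρ δ)| ≤ 4 * Real.log K * N := by
  obtain ⟨p, hp⟩ := SimpleGraph.exists_walk_of_edist_ne_top
    (ne_top_of_le_ne_top (ENat.natCast_ne_top N) h)
  have hlen : p.length ≤ N := by
    rw [cayleyDist, ← hp] at h
    exact_mod_cast h
  have := abs_gap_sub_le_of_walk (K := K) hm (WithOne.lift ρ) (fun f hf => by simpa using hρ f hf) p
  simp only [AddIdentity.of, WithOne.lift_coe] at this
  have hlog := Real.log_nonneg hK
  exact this.trans (mul_le_mul_of_nonneg_left (by exact_mod_cast hlen) (by positivity))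

lemma map_segProd {G : Type*} [Monoid G] (ρ : Λ →ₙ* G) (f : ℕ → Λ) (k l : ℕ) :
    ρ (segProd f k l) = segment (fun j => ρ (f j)) k (l + 1) := by
  induction l with
  | zero => simp [segProd, segment]
  | succ l ih => rw [segProd, map_mul, ih, segment_succ _ _ (l + 1)]

lemma segment_eq_prod_map {G : Type*} [Monoid G] (ρ : Λ →ₙ* G) (f : ℕ → Λ) (k l : ℕ) :
    segment (fun j => ρ (f j)) k l = (((List.range l).map fun j => f (k + j)).map ρ).prod := by
  simp [segment, Function.comp_def]

lemma isAnosov_iff (hm : m + 2 ≤ d) (ρ : Λ →ₙ* GL (Fin d) ℝ) :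
    IsAnosov F (m + 1) ρ ↔ ∃ c c' : ℝ, 0 < c ∧ 0 < c' ∧
      ∀ γ : Λ, c * (wordLength F γ : ℝ) - c' ≤ gap m (ρ γ) := by
  simp only [IsAnosov, logSing_sub _ hm]

/-- A homomorphism close on `F` to a homomorphism with linearly growing gaps has itself linearly
growing gaps along uniform quasigeodesics. -/
lemma gap_segment_ge_of_QG {κ κ' c c' : ℝ} (hκ' : 0 ≤ κ') (hc : 0 < c) (hc' : 0 < c')
    {ρ ρ₀ : Λ →ₙ* GL (Fin d) ℝ} (hρ₀ : ∀ γ : Λ, c * (wordLength F γ : ℝ) - c' ≤ gap m (ρ₀ γ)) {n : ℕ}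
    (hρ : ∀ w ∈ {w : List Λ | w.length ≤ n ∧ ∀ x ∈ w, x ∈ F},
      gap m (w.map ρ₀).prod - 1 < gap m (w.map ρ).prod)
    {f : ℕ → Λ} (hf : f ∈ QG F κ κ') (k l : ℕ) (hl : l ≤ n) :
    c * κ * l - (c * κ' + c' + 1) ≤ gap m (segment (fun j => ρ (f j)) k l) := by
  have h1 := hρ ((List.range l).map fun j => f (k + j)) ⟨by simpa using hl, by
    intro x hx
    obtain ⟨j, -, rfl⟩ := List.mem_map.1 hx
    exact hf.1 _⟩
  rw [← segment_eq_prod_map, ← segment_eq_prod_map] at h1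
  have h2 : c * κ * l - (c * κ' + c') ≤ gap m (segment (fun j => ρ₀ (f j)) k l) := by
    cases l with
    | zero =>
      have := mul_nonneg hc.le hκ'
      simp [gap_one]
      linarith
    | succ l =>
      rw [← map_segProd]
      have h3 := mul_le_mul_of_nonneg_left (hf.2 k l) hc.le
      push_cast
      linarith [hρ₀ (segProd f k l)]
  linarith

end Openness

end AnosovSemigroup

end

open AnosovSemigroup in
theorem corollary5p12 {Λ : Type*} [Semigroup Λ] (F : Set Λ) (hFfin : F.Finite)
    (hFgen : AnosovSemigroup.Generates F) (hD : AnosovSemigroup.PropertyD F)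
    (d i : ℕ) (hi : 1 ≤ i) (hid : i < d) :
    IsOpen[AnosovSemigroup.homTopology F d]
      {ρ : Λ →ₙ* GL (Fin d) ℝ | AnosovSemigroup.IsAnosov F i ρ} := by
  obtain ⟨m, rfl⟩ := Nat.exists_eq_add_of_le' hi
  have hm : m + 2 ≤ d := hid
  let := homTopology F d
  have heval : ∀ f ∈ F, Continuous fun ρ : Λ →ₙ* GL (Fin d) ℝ => ρ f := fun f hf => by
    have h1 : Continuous fun (ρ : Λ →ₙ* GL (Fin d) ℝ) (x : F) => ρ (x : Λ) :=
      continuous_induced_dom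
    exact (continuous_apply (⟨f, hf⟩ : F)).comp h1
  refine isOpen_iff_mem_nhds.2 fun ρ₀ hρ₀ => ?_
  obtain ⟨c, c', hc, hc', hgap⟩ := (isAnosov_iff hm ρ₀).1 hρ₀
  obtain ⟨κ, κ', N, hκ, -, hκ', hdense⟩ := hD
  have hbound : ∃ K : ℝ, 3 ≤ K ∧ ∀ᶠ ρ in 𝓝 ρ₀, ∀ f ∈ F, CompoundBound m K (ρ f) := by
    choose K hK using fun f : Λ => exists_eventually_compoundBound m (ρ₀ f)
    obtain ⟨M, hM⟩ := (hFfin.image K).bddAbove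
    refine ⟨max M 3, le_max_right _ _, (Filter.eventually_all_finite hFfin).2 fun f hf => ?_⟩
    exact ((heval f hf).continuousAt.eventually (hK f)).mono fun ρ h =>
      h.mono ((hM ⟨f, hf, rfl⟩).trans (le_max_left _ _))
  obtain ⟨K, hK3, hK⟩ := hbound
  have hK1 : 1 ≤ K := by linarith
  obtain ⟨n, hn⟩ := exists_length_forall_gap (d := d) hm (c' := c * κ' + c' + 1) hK1 (mul_pos hc hκ)
  have hwords : ∀ᶠ ρ : Λ →ₙ* GL (Fin d) ℝ in 𝓝 ρ₀,
      ∀ w ∈ {w : List Λ | w.length ≤ n ∧ ∀ x ∈ w, x ∈ F},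
        gap m (w.map ρ₀).prod - 1 < gap m (w.map ρ).prod := by
    refine (Filter.eventually_all_finite (finite_words hFfin n)).2 fun w hw => ?_
    have hcont : Continuous fun ρ : Λ →ₙ* GL (Fin d) ℝ => gap m (w.map ρ).prod :=
      (continuous_gap hm).comp (continuous_list_prod w fun f hf => heval f (hw.2 f hf))
    exact hcont.continuousAt.eventually_const_lt (sub_one_lt _)
  filter_upwards [hK, hwords] with ρ hρK hρw
  set Q := 4 * Real.log K
  have hQ : 0 < Q := mul_pos four_pos (Real.log_pos (by linarith))
  refine (isAnosov_iff hm ρ).2 ⟨c * κ / 2 * (c / Q), c * κ / 2 * (c' / Q + N) +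
    (c * κ' + c' + 1) + Q * N, by positivity, by positivity, fun γ => ?_⟩
  obtain ⟨f, hf, l, hfl⟩ := hdense γ
  have h1 := abs_le.1 (abs_gap_sub_le_of_cayleyDist hK1 hm ρ hρK hfl)
  have h2 := abs_le.1 (abs_gap_sub_le_of_cayleyDist hK1 hm ρ₀ hK.self_of_nhds hfl)
  rw [map_segProd] at h1 h2
  have h3 := gap_segment_le hm (A := fun j => ρ₀ (f j))
    (fun k => hK.self_of_nhds _ (hf.1 k)) 0 (l + 1)
  have h4 := hn (fun j => ρ (f j)) (fun k => hρK _ (hf.1 k))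
    (fun k q hq => gap_segment_ge_of_QG hκ' hc hc' hgap hρw hf k q hq) 0 (l + 1)
  have h5 : c / Q * wordLength F γ - (c' / Q + N) ≤ ((l + 1 : ℕ) : ℝ) := by
    have : c * wordLength F γ - c' ≤ Q * (((l + 1 : ℕ) : ℝ) + N) := by
      linarith [hgap γ, h2.2]
    rw [← div_le_iff₀' hQ, sub_div] at this
    rw [div_mul_eq_mul_div]
    linarith
  have h6 := mul_le_mul_of_nonneg_left h5 (by positivity : 0 ≤ c * κ / 2)
  linarith [h1.1]
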